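/- Let $f_0,f_1$ be fixed probability measures on a measurable space $\mathcal Y$, let $D(f_0\|f_1)=\mathbb E_{0}\big[\log\frac{f_0(y)}{f_1(y)}\big]\in[0,\infty]$ be their Kullback–Leibler divergence, and put $1/0=\infty$, $1/\infty=0$. For each dimension $n$ and each support $\mathcal S\subseteq\{1,\dots,n\}$ let $(y_{i,j})_{1\le i\le n,\,j\ge 1}$ be independent, with $y_{i,j}\sim f_1$ if $i\in\mathcal S$ and $y_{i,j}\sim f_0$ if $i\notin\mathcal S$. A sequential, coordinate-wise measurement procedure consists, for each component $i$, of (measurable) decisions $\pi_{i,j}\in\{0,1\}$, $j\ge 1$, saying whether $y_{i,j}$ is measured, where $\pi_{i,j}$ depends only on those among $y_{i,1},\dots,y_{i,j-1}$ that were measured, and of a final decision whether $i\in\hat{\mathcal S}$, which depends only on the measured $y_{i,j}$, $j\ge1$. Write $\mathbb P(\mathcal E)=\mathbb P(\hat{\mathcal S}\ne\mathcal S)$ for the family-wise error rate, and let $\alpha_i$ (resp. $\beta_i$) be the probability that the decision on component $i$ is $i\in\hat{\mathcal S}$ when its observations follow $f_0$ (resp. $i\notin\hat{\mathcal S}$ when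 they follow $f_1$). Let $s=s_n\le n$ be integers with $s\to\infty$ and $s/n\to0$ as $n\to\infty$, and let $m=m_n\ge0$ be real numbers (for instance integers) such that $$\lim_{n\to\infty}\frac{m}{\log s}\ \text{ exists, is finite, and is } <\frac1{D(f_0\|f_1)} .$$ For each $n$ let a sequential, coordinate-wise procedure be given. (i) Let $\mathcal S=\mathcal S_n$ be any supports with $|\mathcal S|=s$. If the error probabilities are common to all components ($\alpha_i=\alpha$ and $\beta_i=\beta$ for all $i$, where $\alpha,\beta$ may depend on $n$), and if $\mathbb E\big[\sum_{i,j}\pi_{i,j}\big]\le nm$ for all $n$ when the support is $\mathcal S$, then $\mathbb P(\mathcal E)\to1$ as $n\to\infty$. (ii) If the tests may differ arbitrarily from component to component, and if $\mathbb E\big[\sum_{i,j}\pi_{i,j}\big]\le nm$ for all $n$ when $\mathcal S$ is uniformly distributed over the subsets of $\{1,\dots,n\}$ of cardinality $s$, then $\mathbb P(\mathcal E)\to1$ as $n\to\infty$ for this random $\mathcal S$. -/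

import Mathlib

open MeasureTheory ProbabilityTheory Filter Topology InformationTheory
open scoped ENNReal NNReal

/-- A sequential test of one component with potential observations `y 0, y 1, y 2, …` in `Y`.

`query j y` says whether the `j`-th observation is measured; this may depend only on those among
`y 0, …, y (j - 1)` that were themselves measured. Once the measurements are made, `accept`
says whether the component is put into the estimated support; it may depend only on the
observations that were measured. -/
structure SequentialTest (Y : Type*) [MeasurableSpace Y] where
  query : ℕ → (ℕ → Y) → Bool
  measurable_query : ∀ j, Measurable (query j)
  query_congr : ∀ j y y', (∀ k < j, query k y = true → y k = y' k) → query j y = query j y'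
  accept : (ℕ → Y) → Bool
  measurable_accept : Measurable accept
  accept_congr : ∀ y y', (∀ k, query k y = true → y k = y' k) → accept y = accept y'

namespace SequentialTest

variable {Y : Type*} [MeasurableSpace Y]

/-- The number of measurements that the test makes on the observation sequence `y`. -/
noncomputable def numMeasurements (T : SequentialTest Y) (y : ℕ → Y) : ℝ≥0∞ :=
  ∑' j, if T.query j y = true then 1 else 0

end SequentialTest

/-- The law of an i.i.d. sequence with common distribution `f`. -/
noncomputable def iidLaw {Y : Type*} [MeasurableSpace Y] (f : Measure Y)
    [IsProbabilityMeasure f] : Measure (ℕ → Y) :=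
  Measure.infinitePi (fun _ : ℕ => f)

namespace SequentialTest

variable {Y : Type*} [MeasurableSpace Y]

/-- The probability that a component following the null distribution `f₀` is put into the
estimated support. -/
noncomputable def falsePositive (T : SequentialTest Y) (f₀ : Measure Y)
    [IsProbabilityMeasure f₀] : ℝ :=
  (iidLaw f₀).real {y | T.accept y = true}

/-- The probability that a component following the alternative distribution `f₁` is left out of
the estimated support. -/
noncomputable def falseNegative (T : SequentialTest Y) (f₁ : Measure Y)
    [IsProbabilityMeasure f₁] : ℝ :=
  (iidLaw f₁).real {y | T.accept y = false}

end SequentialTest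

/-- The law of all potential observations `y i j` when the support is `S`: they are independent,
with distribution `f₁` if `i ∈ S` and `f₀` if `i ∉ S`. -/
noncomputable def dataLaw {Y : Type*} [MeasurableSpace Y] (f₀ f₁ : Measure Y)
    [IsProbabilityMeasure f₀] [IsProbabilityMeasure f₁] {n : ℕ} (S : Finset (Fin n)) :
    Measure (Fin n → ℕ → Y) :=
  Measure.pi (fun i => if i ∈ S then iidLaw f₁ else iidLaw f₀)

/-- A coordinate-wise sequential procedure in dimension `n`: one sequential test per component,
which sees only the observations of that component. -/
abbrev SequentialProcedure (Y : Type*) [MeasurableSpace Y] (n : ℕ) : Type _ :=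
  Fin n → SequentialTest Y

namespace SequentialProcedure

variable {Y : Type*} [MeasurableSpace Y] {n : ℕ}

/-- The estimated support. -/
def estimate (T : SequentialProcedure Y n) (y : Fin n → ℕ → Y) : Finset (Fin n) :=
  Finset.univ.filter (fun i => (T i).accept (y i) = true)

/-- The family-wise error rate: the probability that the estimated support is not `S` when the
support is `S`. -/
noncomputable def errorProb (T : SequentialProcedure Y n) (f₀ f₁ : Measure Y)
    [IsProbabilityMeasure f₀] [IsProbabilityMeasure f₁] (S : Finset (Fin n)) : ℝ :=
  (dataLaw f₀ f₁ S).real {y | estimate T y ≠ S}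

/-- The expected total number of measurements when the support is `S`. -/
noncomputable def expectedMeasurements (T : SequentialProcedure Y n) (f₀ f₁ : Measure Y)
    [IsProbabilityMeasure f₀] [IsProbabilityMeasure f₁] (S : Finset (Fin n)) : ℝ≥0∞ :=
  ∫⁻ y, ∑ i, (T i).numMeasurements (y i) ∂(dataLaw f₀ f₁ S)

/-- The family-wise error rate when the support is uniformly distributed over the subsets of
cardinality `s`. -/
noncomputable def avgErrorProb (T : SequentialProcedure Y n) (f₀ f₁ : Measure Y)
    [IsProbabilityMeasure f₀] [IsProbabilityMeasure f₁] (s : ℕ) : ℝ :=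
  (∑ S ∈ Finset.powersetCard s (Finset.univ : Finset (Fin n)), errorProb T f₀ f₁ S) /
    (n.choose s : ℝ)

/-- The expected total number of measurements when the support is uniformly distributed over the
subsets of cardinality `s`. -/
noncomputable def avgExpectedMeasurements (T : SequentialProcedure Y n) (f₀ f₁ : Measure Y)
    [IsProbabilityMeasure f₀] [IsProbabilityMeasure f₁] (s : ℕ) : ℝ≥0∞ :=
  (∑ S ∈ Finset.powersetCard s (Finset.univ : Finset (Fin n)), expectedMeasurements T f₀ f₁ S) /
    (n.choose s : ℝ≥0∞)

end SequentialProcedure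

/-! A test that measures little on average under `f₀` cannot separate the hypotheses.
Donsker–Varadhan duality for `c` times the indicator of rejection, with Wald's identity bounding the
divergence of the measured data by `D * E₀[N]`, gives `c * (1 - α) ≤ D * E₀[N] + log (1 + β * exp
c)` (`mul_one_sub_falsePositive_le`). If `l = log s`, `v < w < 1` and `D * E₀[N] ≤ v * l`, the
choice `c = w * l` forces `α > (w - v) / 2` or `β ≥ s ^ (-w)` (`error_large`). Components are
independent. The first alternative on a positive fraction of them makes a false positive almost
certain, as `s` is negligible against `n`; the second makes a false negative almost certain, as `s *
s ^ (-w) → ∞`.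

With common error probabilities, one cheap component decides for all. Otherwise, averaging over
supports shows that a positive fraction of the components is cheap (`card_few_measurements_ge`), and
at least half of these share one alternative; for false negatives, `sum_powersetCard_prod_le`
handles the random support.

Likelihood ratios of infinite sequences are avoided by truncation: under `changePointLaw f₀ f₁ J`
only the first `J` observations follow `f₀`, so finite products suffice, and then `J → ∞`. -/

/-! ### Resampling and prefix events for infinite product measures. -/

section ProductMeasure

variable {Y : Type*} [MeasurableSpace Y]

/-- Resampling one coordinate of a product measure. -/
theorem map_update_infinitePi (ν ν' : ℕ → Measure Y) [∀ j, IsProbabilityMeasure (ν j)]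
    [∀ j, IsProbabilityMeasure (ν' j)] (k : ℕ) (h : ∀ j, j ≠ k → ν' j = ν j) :
    ((Measure.infinitePi ν).prod (ν' k)).map (fun p => Function.update p.1 k p.2) =
      Measure.infinitePi ν' := by
  apply Measure.eq_infinitePi
  intro s t ht
  have hmeas : Measurable (fun p : (ℕ → Y) × Y => Function.update p.1 k p.2) := by fun_prop
  rw [Measure.map_apply hmeas (MeasurableSet.pi s.countable_toSet fun i _ => ht i)]
  have hpre : (fun p : (ℕ → Y) × Y => Function.update p.1 k p.2) ⁻¹' (Set.pi s t) =
      (Set.pi (s.erase k : Finset ℕ) t) ×ˢ (if k ∈ s then t k else Set.univ) := by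
    ext p
    simp only [Set.mem_preimage, Set.mem_pi, Set.mem_prod, Finset.mem_coe, Finset.mem_erase]
    constructor
    · intro H
      refine ⟨fun i hi => ?_, ?_⟩
      · simpa [Function.update_of_ne hi.1] using H i hi.2
      · split_ifs with hk
        · simpa using H k hk
        · trivial
    · rintro ⟨H1, H2⟩ i hi
      by_cases hik : i = k
      · subst hik
        simpa [hi] using H2
      · simpa [Function.update_of_ne hik] using H1 i ⟨hik, hi⟩
  rw [hpre, Measure.prod_prod, Measure.infinitePi_pi _ (fun i _ => ht i)]
  have herase : ∏ i ∈ s.erase k, ν i (t i) = ∏ i ∈ s.erase k, ν' i (t i) :=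
    Finset.prod_congr rfl fun i hi => by rw [h i (Finset.ne_of_mem_erase hi)]
  rw [herase]
  split_ifs with hk
  · rw [Finset.prod_erase_mul _ _ hk]
  · rw [measure_univ, mul_one, Finset.erase_eq_of_notMem hk]

/-- Two product measures with the same first `J` factors agree on the events that depend only on
the first `J` coordinates. -/
theorem infinitePi_congr_of_prefix (ν ν' : ℕ → Measure Y) [∀ j, IsProbabilityMeasure (ν j)]
    [∀ j, IsProbabilityMeasure (ν' j)] (J : ℕ) (h : ∀ j < J, ν' j = ν j) {A : Set (ℕ → Y)}
    (hA : MeasurableSet A) (hdep : ∀ y y', (∀ j < J, y j = y' j) → (y ∈ A ↔ y' ∈ A)) :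
    Measure.infinitePi ν' A = Measure.infinitePi ν A := by
  -- `y0` only pads the sequence from time `J` on, where `A` does not look.
  obtain ⟨y0⟩ : Nonempty Y := (ν 0).nonempty_of_neZero
  let e : ((Finset.range J) → Y) → (ℕ → Y) :=
    fun x j => if hj : j ∈ Finset.range J then x ⟨j, hj⟩ else y0
  have he : Measurable e := by
    refine measurable_pi_lambda _ fun j => ?_
    by_cases hj : j ∈ Finset.range J
    · simp only [e, hj, dite_true]; fun_prop
    · simp only [e, hj, dite_false]; fun_prop
  have hpre : A = (Finset.range J).restrict ⁻¹' (e ⁻¹' A) := by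
    ext y
    refine hdep _ _ fun j hj => ?_
    simp [e, hj]
  rw [hpre, ← Measure.map_apply (Finset.measurable_restrict _) (he hA),
    ← Measure.map_apply (Finset.measurable_restrict _) (he hA),
    Measure.infinitePi_map_restrict, Measure.infinitePi_map_restrict]
  congr 2
  funext i
  exact h i (Finset.mem_range.1 i.2)

end ProductMeasure

/-! ### Change of measure along the measured observations. -/

/-- Reweighting `f₀` by `df₁/df₀` gives at most `f₁`. -/
theorem lintegral_mul_exp_neg_llr_le {Y : Type*} [MeasurableSpace Y] (f₀ f₁ : Measure Y)
    [IsProbabilityMeasure f₀] [IsProbabilityMeasure f₁] (hac : f₀ ≪ f₁) {g : Y → ℝ≥0∞}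
    (hg : Measurable g) :
    ∫⁻ z, g z * ENNReal.ofReal (Real.exp (-llr f₀ f₁ z)) ∂f₀ ≤ ∫⁻ z, g z ∂f₁ := by
  have hm : Measurable fun z => g z * ENNReal.ofReal (Real.exp (-llr f₀ f₁ z)) :=
    hg.mul (Real.measurable_exp.comp (measurable_llr f₀ f₁).neg).ennreal_ofReal
  rw [← lintegral_rnDeriv_mul hac hm.aemeasurable]
  refine lintegral_mono_ae ?_
  filter_upwards [Measure.rnDeriv_lt_top f₀ f₁] with z hz
  -- Where the density vanishes the left side is zero but `f₁` may have mass; hence an inequality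
  -- only.
  rcases eq_or_ne (f₀.rnDeriv f₁ z) 0 with h0 | h0
  · simp [h0]
  · have hpos : 0 < (f₀.rnDeriv f₁ z).toReal := ENNReal.toReal_pos h0 hz.ne
    have : f₀.rnDeriv f₁ z = ENNReal.ofReal (f₀.rnDeriv f₁ z).toReal :=
      (ENNReal.ofReal_toReal hz.ne).symm
    rw [llr_def, mul_left_comm]
    simp only
    rw [Real.exp_neg, Real.exp_log hpos, ENNReal.ofReal_inv_of_pos hpos, ENNReal.ofReal_toReal hz.ne,
      ENNReal.mul_inv_cancel h0 hz.ne, mul_one]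

/-- The law of the `j`-th observation when the first `J` observations follow `f₀` and the others
follow `f₁`. -/
noncomputable def changePointFactor {Y : Type*} [MeasurableSpace Y] (f₀ f₁ : Measure Y) (J j : ℕ) :
    Measure Y :=
  if j < J then f₀ else f₁

instance {Y : Type*} [MeasurableSpace Y] (f₀ f₁ : Measure Y)
    [IsProbabilityMeasure f₀] [IsProbabilityMeasure f₁] (J j : ℕ) :
    IsProbabilityMeasure (changePointFactor f₀ f₁ J j) := by
  unfold changePointFactor
  split_ifs <;> infer_instance

/-- The law of a sequence of independent observations of which the first `J` follow `f₀` and the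
others follow `f₁`. -/
noncomputable def changePointLaw {Y : Type*} [MeasurableSpace Y] (f₀ f₁ : Measure Y)
    [IsProbabilityMeasure f₀] [IsProbabilityMeasure f₁] (J : ℕ) : Measure (ℕ → Y) :=
  Measure.infinitePi (changePointFactor f₀ f₁ J)

instance {Y : Type*} [MeasurableSpace Y] (f₀ f₁ : Measure Y)
    [IsProbabilityMeasure f₀] [IsProbabilityMeasure f₁] (J : ℕ) :
    IsProbabilityMeasure (changePointLaw f₀ f₁ J) := by
  unfold changePointLaw
  infer_instance

instance {Y : Type*} [MeasurableSpace Y] (f : Measure Y) [IsProbabilityMeasure f] :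
    IsProbabilityMeasure (iidLaw f) := by
  unfold iidLaw
  infer_instance

theorem changePointLaw_zero {Y : Type*} [MeasurableSpace Y] (f₀ f₁ : Measure Y)
    [IsProbabilityMeasure f₀] [IsProbabilityMeasure f₁] :
    changePointLaw f₀ f₁ 0 = iidLaw f₁ := by
  unfold changePointLaw iidLaw
  congr 1

namespace SequentialTest

variable {Y : Type*} [MeasurableSpace Y] (T : SequentialTest Y)

theorem query_eq_of_agree {y y' : ℕ → Y} (h : ∀ k, T.query k y = true → y k = y' k) (j : ℕ) :
    T.query j y = T.query j y' :=
  T.query_congr j y y' fun k _ => h k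

theorem query_update (k : ℕ) (y : ℕ → Y) (z : Y) :
    T.query k (Function.update y k z) = T.query k y :=
  (T.query_congr k _ _ fun j hj _ => by rw [Function.update_of_ne hj.ne]).symm.symm

theorem agree_update {k : ℕ} {y : ℕ → Y} (hk : T.query k y = false) (z : Y) (j : ℕ)
    (hj : T.query j y = true) : y j = Function.update y k z j := by
  rw [Function.update_of_ne]
  rintro rfl
  simp [hk] at hj

/-- The likelihood ratio of the `k`-th observation, if it is measured. -/
noncomputable def weight (f₀ f₁ : Measure Y) (k : ℕ) (y : ℕ → Y) : ℝ≥0∞ :=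
  if T.query k y = true then ENNReal.ofReal (Real.exp (-llr f₀ f₁ (y k))) else 1

theorem measurable_weight (f₀ f₁ : Measure Y) (k : ℕ) : Measurable (T.weight f₀ f₁ k) := by
  unfold weight
  refine Measurable.ite (T.measurable_query k (measurableSet_singleton true)) ?_ measurable_const
  exact (Real.measurable_exp.comp
    ((measurable_llr f₀ f₁).comp (measurable_pi_apply k)).neg).ennreal_ofReal

theorem weight_congr (f₀ f₁ : Measure Y) (k : ℕ) {y y' : ℕ → Y}
    (h : ∀ k, T.query k y = true → y k = y' k) :
    T.weight f₀ f₁ k y = T.weight f₀ f₁ k y' := by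
  unfold weight
  rw [← T.query_eq_of_agree h k]
  split_ifs with hk
  · rw [h k hk]
  · rfl

variable (f₀ f₁ : Measure Y) [IsProbabilityMeasure f₀] [IsProbabilityMeasure f₁]

theorem changePointLaw_map_update (k J : ℕ) (f : Measure Y)
    (hf : f = changePointFactor f₀ f₁ J k) :
    ((changePointLaw f₀ f₁ J).prod f).map (fun p => Function.update p.1 k p.2) =
      changePointLaw f₀ f₁ J := by
  subst hf
  exact map_update_infinitePi _ _ k fun _ _ => rfl

theorem changePointLaw_map_update_succ (k : ℕ) :
    ((changePointLaw f₀ f₁ k).prod f₀).map (fun p => Function.update p.1 k p.2) =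
      changePointLaw f₀ f₁ (k + 1) := by
  have := map_update_infinitePi (changePointFactor f₀ f₁ k) (changePointFactor f₀ f₁ (k + 1)) k
    fun j hj => by
      unfold changePointFactor
      have : j < k + 1 ↔ j < k := by omega
      simp [this]
  have hk : changePointFactor f₀ f₁ (k + 1) k = f₀ := by simp [changePointFactor]
  rwa [hk] at this

/-- Moving the change point by one step, for functions of the measured observations. -/
theorem lintegral_mul_weight_le (hac : f₀ ≪ f₁) (k : ℕ) {g : (ℕ → Y) → ℝ≥0∞} (hg : Measurable g)
    (hobs : ∀ y y', (∀ k, T.query k y = true → y k = y' k) → g y = g y') :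
    ∫⁻ y, g y * T.weight f₀ f₁ k y ∂(changePointLaw f₀ f₁ (k + 1)) ≤
      ∫⁻ y, g y ∂(changePointLaw f₀ f₁ k) := by
  have hup : Measurable (fun p : (ℕ → Y) × Y => Function.update p.1 k p.2) := by fun_prop
  have hgw : Measurable fun y => g y * T.weight f₀ f₁ k y := hg.mul (T.measurable_weight f₀ f₁ k)
  rw [← changePointLaw_map_update_succ, lintegral_map hgw hup,
    lintegral_prod _ (by exact (hgw.comp hup).aemeasurable)]
  -- Both laws arise from `changePointLaw f₀ f₁ k` by redrawing coordinate `k`, from `f₀` on the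
  -- left and from `f₁` on the right.
  conv_rhs => rw [← changePointLaw_map_update f₀ f₁ k k f₁ (by simp [changePointFactor]),
    lintegral_map hg hup, lintegral_prod _ (by exact (hg.comp hup).aemeasurable)]
  refine lintegral_mono fun y => ?_
  have hgy : Measurable fun z => g (Function.update y k z) := hg.comp (by fun_prop)
  -- If time `k` is measured, the weight turns the `f₀` draw into an `f₁` draw; if not, `g` does not
  -- see the draw.
  cases hq : T.query k y with
  | true =>
    simp only [weight, T.query_update, hq, if_true, Function.update_self]
    exact lintegral_mul_exp_neg_llr_le f₀ f₁ hac hgy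
  | false =>
    have hc : ∀ z, g (Function.update y k z) = g y := fun z =>
      (hobs _ _ (T.agree_update hq z)).symm
    simp [weight, T.query_update, hq, hc]

/-- The one-step bound telescopes: each weight is itself a function of the measured data, so the
earlier weights can be absorbed into `g`. -/
theorem lintegral_mul_prod_weight_le (hac : f₀ ≪ f₁) (J : ℕ) {g : (ℕ → Y) → ℝ≥0∞}
    (hg : Measurable g) (hobs : ∀ y y', (∀ k, T.query k y = true → y k = y' k) → g y = g y') :
    ∫⁻ y, g y * ∏ k ∈ Finset.range J, T.weight f₀ f₁ k y ∂(changePointLaw f₀ f₁ J) ≤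
      ∫⁻ y, g y ∂(iidLaw f₁) := by
  induction J with
  | zero => simp [changePointLaw_zero]
  | succ J ih =>
    refine le_trans ?_ ih
    have := T.lintegral_mul_weight_le f₀ f₁ hac J
      (g := fun y => g y * ∏ k ∈ Finset.range J, T.weight f₀ f₁ k y)
      (hg.mul (Finset.measurable_prod _ fun k _ => T.measurable_weight f₀ f₁ k))
      (fun y y' h => by
        rw [hobs y y' h, Finset.prod_congr rfl fun k _ => T.weight_congr f₀ f₁ k h])
    simpa only [Finset.prod_range_succ, mul_assoc] using this

end SequentialTest

/-! ### The information inequality for one sequential test. -/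

/-- Jensen's inequality for the exponential function. -/
theorem exp_integral_le_integral_exp {Ω : Type*} [MeasurableSpace Ω] (μ : Measure Ω)
    [IsProbabilityMeasure μ] {X : Ω → ℝ} (hX : Integrable X μ)
    (hexp : Integrable (fun ω => Real.exp (X ω)) μ) :
    Real.exp (∫ ω, X ω ∂μ) ≤ ∫ ω, Real.exp (X ω) ∂μ :=
  convexOn_exp.map_integral_le Real.continuous_exp.continuousOn isClosed_univ (by simp) hX hexp

namespace SequentialTest

variable {Y : Type*} [MeasurableSpace Y] (T : SequentialTest Y)
theorem measurableSet_query (k : ℕ) : MeasurableSet {y | T.query k y = true} :=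
  T.measurable_query k (measurableSet_singleton true)

theorem measurableSet_reject : MeasurableSet {y | T.accept y = false} :=
  T.measurable_accept (measurableSet_singleton false)

theorem measurable_numMeasurements : Measurable T.numMeasurements :=
  Measurable.tsum fun j =>
    Measurable.ite (T.measurableSet_query j) measurable_const measurable_const

theorem lintegral_numMeasurements (μ : Measure (ℕ → Y)) :
    ∫⁻ y, T.numMeasurements y ∂μ = ∑' j, μ {y | T.query j y = true} := by
  unfold numMeasurements
  rw [lintegral_tsum fun j =>
    (Measurable.ite (T.measurableSet_query j) measurable_const measurable_const).aemeasurable]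
  refine tsum_congr fun j => ?_
  rw [← lintegral_indicator_one (T.measurableSet_query j)]
  refine lintegral_congr fun y => ?_
  simp [Set.indicator_apply]

variable (f₀ f₁ : Measure Y)

/-- The log-likelihood ratio of the `k`-th observation, if it is measured. -/
noncomputable def llrTerm (k : ℕ) (y : ℕ → Y) : ℝ :=
  if T.query k y = true then llr f₀ f₁ (y k) else 0

theorem weight_eq_exp_llrTerm (k : ℕ) (y : ℕ → Y) :
    T.weight f₀ f₁ k y = ENNReal.ofReal (Real.exp (-T.llrTerm f₀ f₁ k y)) := by
  unfold weight llrTerm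
  split_ifs <;> simp

theorem measurable_llrTerm (k : ℕ) : Measurable (T.llrTerm f₀ f₁ k) :=
  Measurable.ite (T.measurableSet_query k)
    ((measurable_llr f₀ f₁).comp (measurable_pi_apply k)) measurable_const

theorem llrTerm_update (k : ℕ) (y : ℕ → Y) (z : Y) :
    T.llrTerm f₀ f₁ k (Function.update y k z) =
      Set.indicator {y | T.query k y = true} 1 y * llr f₀ f₁ z := by
  simp only [llrTerm, T.query_update, Function.update_self, Set.indicator_apply,
    Set.mem_ofPred_eq]
  split_ifs <;> simp

variable [IsProbabilityMeasure f₀] [IsProbabilityMeasure f₁]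

theorem integrable_llrTerm (hint : Integrable (llr f₀ f₁) f₀) {k J : ℕ} (hk : k < J) :
    Integrable (T.llrTerm f₀ f₁ k) (changePointLaw f₀ f₁ J) := by
  have hup : Measurable (fun p : (ℕ → Y) × Y => Function.update p.1 k p.2) := by fun_prop
  rw [← changePointLaw_map_update f₀ f₁ k J f₀ (by simp [changePointFactor, hk]),
    integrable_map_measure (T.measurable_llrTerm f₀ f₁ k).aestronglyMeasurable hup.aemeasurable]
  simp only [Function.comp_def, llrTerm_update]
  exact Integrable.mul_prod (((integrable_const (1 : ℝ)).indicator (T.measurableSet_query k))) hint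

/-- Wald's identity, term by term. -/
theorem integral_llrTerm {k J : ℕ} (hk : k < J) :
    ∫ y, T.llrTerm f₀ f₁ k y ∂(changePointLaw f₀ f₁ J) =
      (changePointLaw f₀ f₁ J).real {y | T.query k y = true} * ∫ z, llr f₀ f₁ z ∂f₀ := by
  have hup : Measurable (fun p : (ℕ → Y) × Y => Function.update p.1 k p.2) := by fun_prop
  conv_lhs => rw [← changePointLaw_map_update f₀ f₁ k J f₀ (by simp [changePointFactor, hk]),
    integral_map hup.aemeasurable (T.measurable_llrTerm f₀ f₁ k).aestronglyMeasurable]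
  -- Whether time `k` is measured is independent of the value observed there, so the mean
  -- factorises.
  simp only [llrTerm_update]
  rw [integral_prod_mul, integral_indicator_one (T.measurableSet_query k)]

theorem changePointLaw_query {k J : ℕ} (hk : k < J) :
    changePointLaw f₀ f₁ J {y | T.query k y = true} = iidLaw f₀ {y | T.query k y = true} := by
  refine infinitePi_congr_of_prefix (fun _ => f₀) _ J (fun j hj => by simp [changePointFactor, hj])
    (T.measurableSet_query k) fun y y' h => ?_
  rw [Set.mem_ofPred_eq, Set.mem_ofPred_eq, T.query_congr k y y' fun j hj _ => h j (hj.trans hk)]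

/-- The sequences that are rejected without a measurement at time `J` or later. -/
def rejectBefore (J : ℕ) : Set (ℕ → Y) :=
  {y | T.accept y = false} ∩ {y | ∀ k, J ≤ k → T.query k y = false}

theorem measurableSet_rejectBefore (J : ℕ) : MeasurableSet (T.rejectBefore J) := by
  refine T.measurableSet_reject.inter ?_
  simp only [Set.ofPred_forall]
  exact MeasurableSet.iInter fun k => MeasurableSet.iInter fun _ =>
    T.measurable_query k (measurableSet_singleton false)

/-- Nothing is measured from time `J` on, so agreement before `J` is agreement on all the measured
observations. -/
theorem rejectBefore_of_agree {J : ℕ} {y y' : ℕ → Y} (h : ∀ j < J, y j = y' j)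
    (hy : y ∈ T.rejectBefore J) : y' ∈ T.rejectBefore J := by
  have hag : ∀ k, T.query k y = true → y k = y' k := fun k hk => by
    refine h k (lt_of_not_ge fun hJ => ?_)
    simp [hy.2 k hJ] at hk
  refine ⟨?_, fun k hk => ?_⟩
  · rw [Set.mem_ofPred_eq, ← T.accept_congr y y' hag]
    exact hy.1
  · rw [← T.query_eq_of_agree hag]
    exact hy.2 k hk

theorem changePointLaw_rejectBefore (J : ℕ) :
    changePointLaw f₀ f₁ J (T.rejectBefore J) = iidLaw f₀ (T.rejectBefore J) :=
  infinitePi_congr_of_prefix (fun _ => f₀) _ J (fun j hj => by simp [changePointFactor, hj])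
    (T.measurableSet_rejectBefore J) fun _ _ h =>
      ⟨T.rejectBefore_of_agree h, T.rejectBefore_of_agree fun j hj => (h j hj).symm⟩

theorem real_reject : (iidLaw f₀).real {y | T.accept y = false} = 1 - T.falsePositive f₀ := by
  have hset : {y | T.accept y = false} = {y | T.accept y = true}ᶜ := by
    ext y; simp
  have hm : MeasurableSet {y | T.accept y = true} :=
    T.measurable_accept (measurableSet_singleton true)
  rw [hset, probReal_compl_eq_one_sub hm]
  rfl

/-- A finite mean makes the number of measurements almost surely finite, so almost every rejected
sequence is rejected before some `J`; continuity from below gives the limit. -/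
theorem tendsto_rejectBefore (hN : ∫⁻ y, T.numMeasurements y ∂(iidLaw f₀) ≠ ∞) :
    Tendsto (fun J => (iidLaw f₀).real (T.rejectBefore J)) atTop
      (𝓝 ((iidLaw f₀).real {y | T.accept y = false})) := by
  have hmono : Monotone T.rejectBefore := fun J K hJK y hy =>
    ⟨hy.1, fun k hk => hy.2 k (hJK.trans hk)⟩
  have hlim := tendsto_measure_iUnion_atTop (μ := iidLaw f₀) hmono
  have heq : iidLaw f₀ (⋃ J, T.rejectBefore J) = iidLaw f₀ {y | T.accept y = false} := by
    refine measure_congr ?_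
    filter_upwards [ae_lt_top T.measurable_numMeasurements hN] with y hy
    refine propext ⟨fun h => ?_, fun h => ?_⟩
    · obtain ⟨J, hJ⟩ := Set.mem_iUnion.1 h
      exact hJ.1
    -- The terms of a convergent series are eventually below one; being zero or one, they then
    -- vanish.
    · have h0 := ENNReal.tendsto_cofinite_zero_of_tsum_ne_top hy.ne
      rw [Nat.cofinite_eq_atTop] at h0
      obtain ⟨J, hJ⟩ := eventually_atTop.1 (h0.eventually (gt_mem_nhds zero_lt_one))
      refine Set.mem_iUnion.2 ⟨J, h, fun k hk => ?_⟩
      by_contra hne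
      have hlt : (if T.query k y = true then (1 : ℝ≥0∞) else 0) < 1 := hJ k hk
      rw [if_pos (by simpa using hne)] at hlt
      exact lt_irrefl _ hlt
  rw [heq] at hlim
  exact (ENNReal.tendsto_toReal (measure_ne_top _ _)).comp hlim

theorem lintegral_exp_reject_le (c : ℝ) (μ : Measure (ℕ → Y))
    [IsProbabilityMeasure μ] :
    ∫⁻ y, ENNReal.ofReal (Real.exp (Set.indicator {y | T.accept y = false} (fun _ => c) y)) ∂μ ≤
      ENNReal.ofReal (1 + μ.real {y | T.accept y = false} * Real.exp c) := by
  have hpt : ∀ y, ENNReal.ofReal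
      (Real.exp (Set.indicator {y | T.accept y = false} (fun _ => c) y)) ≤
      1 + Set.indicator {y | T.accept y = false} (fun _ => ENNReal.ofReal (Real.exp c)) y := by
    intro y
    by_cases hy : y ∈ {y | T.accept y = false}
    · simp [Set.indicator_of_mem hy]
    · simp [Set.indicator_of_notMem hy]
  refine (lintegral_mono hpt).trans ?_
  rw [lintegral_add_left measurable_const, lintegral_indicator_const T.measurableSet_reject,
    lintegral_const, measure_univ, mul_one, ENNReal.ofReal_add zero_le_one (by positivity),
    ENNReal.ofReal_one, ENNReal.ofReal_mul measureReal_nonneg, ofReal_measureReal, mul_comm]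

/-- The information inequality for the observations before time `J`. -/
theorem mul_rejectBefore_le (hD : klDiv f₀ f₁ ≠ ∞)
    (hN : ∫⁻ y, T.numMeasurements y ∂(iidLaw f₀) ≠ ∞) {c : ℝ} (hc : 0 ≤ c) (J : ℕ) :
    c * (iidLaw f₀).real (T.rejectBefore J) ≤
      (klDiv f₀ f₁).toReal * (∫⁻ y, T.numMeasurements y ∂(iidLaw f₀)).toReal +
        Real.log (1 + T.falseNegative f₁ * Real.exp c) := by
  obtain ⟨hac, hint⟩ := klDiv_ne_top_iff.1 hD
  have hDeq : (klDiv f₀ f₁).toReal = ∫ z, llr f₀ f₁ z ∂f₀ :=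
    toReal_klDiv_of_measure_eq hac (by simp)
  set μ := changePointLaw f₀ f₁ J with hμ
  set φ : (ℕ → Y) → ℝ := Set.indicator {y | T.accept y = false} (fun _ => c) with hφ
  have hφm : Measurable φ := measurable_const.indicator T.measurableSet_reject
  have hφi : Integrable φ μ := (integrable_const c).indicator T.measurableSet_reject
  set Λ : (ℕ → Y) → ℝ := fun y => ∑ k ∈ Finset.range J, T.llrTerm f₀ f₁ k y with hΛ
  have hΛi : Integrable Λ μ := integrable_finsetSum _ fun k hk =>
    T.integrable_llrTerm f₀ f₁ hint (Finset.mem_range.1 hk)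
  have hβ : 0 ≤ T.falseNegative f₁ := measureReal_nonneg
  -- The weights multiply to `exp (-Λ)`, and `φ` depends only on measured data, so the mean passes
  -- to `f₁`.
  have hexp : ∫⁻ y, ENNReal.ofReal (Real.exp (φ y - Λ y)) ∂μ ≤
      ENNReal.ofReal (1 + T.falseNegative f₁ * Real.exp c) := by
    refine le_trans (le_of_eq ?_) ((T.lintegral_mul_prod_weight_le f₀ f₁ hac J
      (g := fun y => ENNReal.ofReal (Real.exp (φ y))) hφm.exp.ennreal_ofReal ?_).trans
        (T.lintegral_exp_reject_le c (iidLaw f₁)))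
    · refine lintegral_congr fun y => ?_
      simp only [weight_eq_exp_llrTerm]
      rw [← ENNReal.ofReal_prod_of_nonneg fun _ _ => (Real.exp_pos _).le, ← Real.exp_sum,
        ← ENNReal.ofReal_mul (Real.exp_pos _).le, ← Real.exp_add, Finset.sum_neg_distrib,
        sub_eq_add_neg]
    · intro y y' h
      have : φ y = φ y' := by
        simp only [hφ, Set.indicator_apply, Set.mem_ofPred_eq, T.accept_congr y y' h]
      simp only [this]
  have hXm : Measurable fun y => Real.exp (φ y - Λ y) :=
    (hφm.sub (Finset.measurable_sum _ fun k _ => T.measurable_llrTerm f₀ f₁ k)).exp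
  have hXi : Integrable (fun y => Real.exp (φ y - Λ y)) μ := by
    refine ⟨hXm.aestronglyMeasurable, ?_⟩
    rw [hasFiniteIntegral_iff_ofReal (Eventually.of_forall fun _ => (Real.exp_pos _).le)]
    exact hexp.trans_lt ENNReal.ofReal_lt_top
  have hle : ∫ y, Real.exp (φ y - Λ y) ∂μ ≤ 1 + T.falseNegative f₁ * Real.exp c := by
    rw [integral_eq_lintegral_of_nonneg_ae (Eventually.of_forall fun _ => (Real.exp_pos _).le)
      hXm.aestronglyMeasurable]
    exact ENNReal.toReal_le_of_le_ofReal (by positivity) hexp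
  have hlog : ∫ y, (φ y - Λ y) ∂μ ≤ Real.log (1 + T.falseNegative f₁ * Real.exp c) := by
    rw [Real.le_log_iff_exp_le (by positivity)]
    exact (exp_integral_le_integral_exp μ (hφi.sub hΛi) hXi).trans hle
  -- Rejection before `J` has the same probability under the change-point law as under `f₀`; the
  -- other rejections only help, as `c ≥ 0`.
  have hφint : c * (iidLaw f₀).real (T.rejectBefore J) ≤ ∫ y, φ y ∂μ := by
    rw [hφ, integral_indicator_const _ T.measurableSet_reject, smul_eq_mul, mul_comm]
    refine mul_le_mul_of_nonneg_right ?_ hc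
    rw [measureReal_def, ← T.changePointLaw_rejectBefore f₀ f₁, ← measureReal_def]
    exact measureReal_mono Set.inter_subset_left
  have hΛint : ∫ y, Λ y ∂μ ≤
      (klDiv f₀ f₁).toReal * (∫⁻ y, T.numMeasurements y ∂(iidLaw f₀)).toReal := by
    rw [hΛ, integral_finsetSum _ fun k hk =>
      T.integrable_llrTerm f₀ f₁ hint (Finset.mem_range.1 hk),
      Finset.sum_congr rfl fun k hk => T.integral_llrTerm f₀ f₁ (Finset.mem_range.1 hk),
      ← Finset.sum_mul, ← hDeq, mul_comm]
    refine mul_le_mul_of_nonneg_left ?_ ENNReal.toReal_nonneg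
    rw [Finset.sum_congr rfl fun k hk => by
      rw [measureReal_def, T.changePointLaw_query f₀ f₁ (Finset.mem_range.1 hk)],
      ← ENNReal.toReal_sum fun _ _ => measure_ne_top _ _]
    refine ENNReal.toReal_mono hN ?_
    rw [T.lintegral_numMeasurements]
    exact ENNReal.sum_le_tsum _
  rw [integral_sub hφi hΛi] at hlog
  linarith

/-- The expected number of measurements bounds the information that separates the hypotheses. -/
theorem mul_one_sub_falsePositive_le (hD : klDiv f₀ f₁ ≠ ∞)
    (hN : ∫⁻ y, T.numMeasurements y ∂(iidLaw f₀) ≠ ∞) {c : ℝ} (hc : 0 ≤ c) :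
    c * (1 - T.falsePositive f₀) ≤
      (klDiv f₀ f₁).toReal * (∫⁻ y, T.numMeasurements y ∂(iidLaw f₀)).toReal +
        Real.log (1 + T.falseNegative f₁ * Real.exp c) := by
  rw [← T.real_reject f₀]
  exact le_of_tendsto ((T.tendsto_rejectBefore f₀ hN).const_mul c)
    (Eventually.of_forall fun J => T.mul_rejectBefore_le f₀ f₁ hD hN hc J)

end SequentialTest

/-! ### Sampling a random support without replacement. -/

section Sampling

variable {ι : Type*} [Fintype ι] [DecidableEq ι]

/-- Choosing a set of `k + 1` elements and one of its elements is choosing a set of `k` elements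
and one element outside of it. -/
theorem sum_powersetCard_succ_sum_mem {M : Type*} [AddCommMonoid M] (k : ℕ) (F : Finset ι → M) :
    ∑ U ∈ Finset.powersetCard (k + 1) (Finset.univ : Finset ι), ∑ _i ∈ U, F U =
      ∑ V ∈ Finset.powersetCard k (Finset.univ : Finset ι), ∑ i ∈ Vᶜ, F (insert i V) := by
  rw [Finset.sum_sigma', Finset.sum_sigma']
  refine Finset.sum_bij' (fun p _ => ⟨p.1.erase p.2, p.2⟩) (fun p _ => ⟨insert p.2 p.1, p.2⟩)
    ?_ ?_ ?_ ?_ ?_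
  · rintro ⟨U, i⟩ h
    simp only [Finset.mem_sigma, Finset.mem_powersetCard] at h ⊢
    refine ⟨⟨Finset.subset_univ _, ?_⟩, by simp⟩
    rw [Finset.card_erase_of_mem h.2, h.1.2, Nat.add_sub_cancel]
  · rintro ⟨V, i⟩ h
    simp only [Finset.mem_sigma, Finset.mem_powersetCard, Finset.mem_compl] at h ⊢
    refine ⟨⟨Finset.subset_univ _, ?_⟩, by simp⟩
    rw [Finset.card_insert_of_notMem h.2, h.1.2]
  · rintro ⟨U, i⟩ h
    simp only [Finset.mem_sigma] at h
    simp [Finset.insert_erase h.2]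
  · rintro ⟨V, i⟩ h
    simp only [Finset.mem_sigma, Finset.mem_compl] at h
    simp [Finset.erase_insert h.2]
  · rintro ⟨U, i⟩ h
    simp only [Finset.mem_sigma] at h
    simp [Finset.insert_erase h.2]

/-- The elements already drawn, `V`, can use up at most `V.card` elements of `B`, so the next draw
still meets many factors bounded by `1 - b`. -/
theorem sum_compl_le {x : ι → ℝ} (hx1 : ∀ i, x i ≤ 1) {B : Finset ι} {b : ℝ} (hb : 0 ≤ b)
    (hB : ∀ i ∈ B, x i ≤ 1 - b) (V : Finset ι) :
    ∑ i ∈ Vᶜ, x i ≤ (Fintype.card ι - V.card : ℝ) - b * (B.card - V.card) := by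
  have h1 : ∑ i ∈ Vᶜ, x i ≤ ∑ i ∈ Vᶜ, (1 - if i ∈ B then b else 0) := by
    refine Finset.sum_le_sum fun i _ => ?_
    split_ifs with hi
    · exact hB i hi
    · simpa using hx1 i
  have hcard : ((Vᶜ.card : ℕ) : ℝ) = Fintype.card ι - V.card := by
    rw [Finset.card_compl, Nat.cast_sub (Finset.card_le_univ V)]
  have h2 : (B.card : ℝ) - V.card ≤ (Vᶜ ∩ B).card := by
    have h3 : Vᶜ ∩ B = B \ V := by
      ext i
      simp [and_comm]
    rw [h3, sub_le_iff_le_add]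
    exact_mod_cast Finset.card_le_card_sdiff_add_card
  rw [Finset.sum_sub_distrib, Finset.sum_const, nsmul_eq_mul, mul_one, hcard,
    Finset.sum_ite_mem, Finset.sum_const, nsmul_eq_mul, mul_comm] at h1
  nlinarith

/-- The mean of a product over a random set of `s` elements sampled without replacement. -/
theorem sum_powersetCard_prod_le {x : ι → ℝ} (hx0 : ∀ i, 0 ≤ x i) (hx1 : ∀ i, x i ≤ 1)
    {B : Finset ι} {b κ : ℝ} (hb : 0 ≤ b) (hκ : 0 ≤ κ) (hbκ : b * κ ≤ 1)
    (hB : ∀ i ∈ B, x i ≤ 1 - b) {s : ℕ} (hs : s + κ * Fintype.card ι ≤ B.card) :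
    ∑ S ∈ Finset.powersetCard s (Finset.univ : Finset ι), ∏ i ∈ S, x i ≤
      (Fintype.card ι).choose s * (1 - b * κ) ^ s := by
  suffices H : ∀ k ≤ s, ∑ S ∈ Finset.powersetCard k (Finset.univ : Finset ι), ∏ i ∈ S, x i ≤
      (Fintype.card ι).choose k * (1 - b * κ) ^ k from H s le_rfl
  have hBcard : (B.card : ℝ) ≤ Fintype.card ι := by exact_mod_cast Finset.card_le_univ B
  intro k
  induction k with
  | zero => simp
  | succ k ih =>
    intro hk
    have hk' : (k : ℝ) + 1 ≤ s := by exact_mod_cast hk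
    have hN : 0 ≤ κ * Fintype.card ι := by positivity
    have hkN : k ≤ Fintype.card ι := by
      have : (k : ℝ) ≤ Fintype.card ι := by linarith
      exact_mod_cast this
    -- Each set of `k + 1` elements is reached from `k + 1` choices of its last drawn element.
    have hrec : ((k : ℝ) + 1) *
        ∑ S ∈ Finset.powersetCard (k + 1) (Finset.univ : Finset ι), ∏ i ∈ S, x i =
        ∑ V ∈ Finset.powersetCard k (Finset.univ : Finset ι), (∏ i ∈ V, x i) * ∑ i ∈ Vᶜ, x i := by
      have h := sum_powersetCard_succ_sum_mem (ι := ι) k fun S => ∏ i ∈ S, x i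
      rw [Finset.mul_sum]
      refine (Finset.sum_congr rfl fun S hS => ?_).trans (h.trans (Finset.sum_congr rfl fun V _ => ?_))
      · rw [Finset.sum_const, (Finset.mem_powersetCard.1 hS).2, nsmul_eq_mul]
        push_cast
        rfl
      · rw [Finset.mul_sum]
        refine Finset.sum_congr rfl fun i hi => ?_
        rw [Finset.prod_insert (Finset.mem_compl.1 hi), mul_comm]
    have hstep : ∑ V ∈ Finset.powersetCard k (Finset.univ : Finset ι),
        (∏ i ∈ V, x i) * ∑ i ∈ Vᶜ, x i ≤
        ∑ V ∈ Finset.powersetCard k (Finset.univ : Finset ι),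
          (∏ i ∈ V, x i) * ((Fintype.card ι - k) * (1 - b * κ)) := by
      refine Finset.sum_le_sum fun V hV => mul_le_mul_of_nonneg_left ?_
        (Finset.prod_nonneg fun i _ => hx0 i)
      refine (sum_compl_le hx1 hb hB V).trans ?_
      rw [(Finset.mem_powersetCard.1 hV).2]
      -- After `k ≤ s` draws `B` still fills a fraction `κ` of what remains; this is the reason for
      -- the summand `s` in `hs`.
      have h1 : κ * (Fintype.card ι - k) ≤ B.card - k := by
        have : 0 ≤ κ * k := by positivity
        linarith
      nlinarith [mul_le_mul_of_nonneg_left h1 hb]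
    rw [← Finset.sum_mul] at hstep
    have hpos : 0 ≤ ((Fintype.card ι : ℝ) - k) * (1 - b * κ) :=
      mul_nonneg (sub_nonneg.2 (by exact_mod_cast hkN)) (sub_nonneg.2 hbκ)
    have hih := mul_le_mul_of_nonneg_right (ih (Nat.le_of_succ_le hk)) hpos
    have hchoose : ((Fintype.card ι).choose (k + 1) : ℝ) * (k + 1) =
        (Fintype.card ι).choose k * (Fintype.card ι - k) := by
      have := Nat.choose_succ_right_eq (Fintype.card ι) k
      rw [← Nat.cast_sub hkN]
      exact_mod_cast this
    have hk0 : (0 : ℝ) < k + 1 := by positivity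
    refine le_of_mul_le_mul_left ?_ hk0
    calc _ ≤ _ := hrec.le.trans (hstep.trans hih)
      _ = ((Fintype.card ι).choose k * (Fintype.card ι - k)) * (1 - b * κ) ^ (k + 1) := by ring
      _ = _ := by rw [← hchoose]; ring

/-- The number of sets of `s` elements that avoid a given element. -/
theorem sum_powersetCard_sum_compl {M : Type*} [AddCommMonoid M] (s : ℕ) (e : ι → M) :
    ∑ S ∈ Finset.powersetCard s (Finset.univ : Finset ι), ∑ i ∈ Sᶜ, e i =
      (Fintype.card ι - 1).choose s • ∑ i, e i := by
  have h : ∀ S : Finset ι, ∑ i ∈ Sᶜ, e i = ∑ i, if i ∉ S then e i else 0 := fun S => by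
    rw [← Finset.sum_filter]
    congr 1
    ext i
    simp
  simp only [h]
  rw [Finset.sum_comm, Finset.smul_sum]
  refine Finset.sum_congr rfl fun i _ => ?_
  rw [← Finset.sum_filter, Finset.sum_const]
  congr 1
  have : (Finset.powersetCard s (Finset.univ : Finset ι)).filter (fun S => i ∉ S) =
      Finset.powersetCard s (Finset.univ.erase i) := by
    ext S
    simp only [Finset.mem_filter, Finset.mem_powersetCard, Finset.subset_erase]
    tauto
  rw [this, Finset.card_powersetCard, Finset.card_erase_of_mem (Finset.mem_univ i),
    Finset.card_univ]

end Sampling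

/-! ### From single tests to the family-wise error. -/

namespace SequentialTest

variable {Y : Type*} [MeasurableSpace Y] (T : SequentialTest Y) (f : Measure Y)
  [IsProbabilityMeasure f]

theorem falsePositive_nonneg : 0 ≤ T.falsePositive f := measureReal_nonneg

theorem falsePositive_le_one : T.falsePositive f ≤ 1 := measureReal_le_one

theorem falseNegative_nonneg : 0 ≤ T.falseNegative f := measureReal_nonneg

theorem falseNegative_le_one : T.falseNegative f ≤ 1 := measureReal_le_one

theorem real_accept : (iidLaw f).real {y | T.accept y = true} = 1 - T.falseNegative f := by
  have hset : {y | T.accept y = true} = {y | T.accept y = false}ᶜ := by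
    ext y; simp
  rw [hset, probReal_compl_eq_one_sub T.measurableSet_reject]
  rfl

end SequentialTest

namespace SequentialProcedure

variable {Y : Type*} [MeasurableSpace Y] {n : ℕ} (T : SequentialProcedure Y n)
  (f₀ f₁ : Measure Y) [IsProbabilityMeasure f₀] [IsProbabilityMeasure f₁] (S : Finset (Fin n))

instance componentLaw_isProbabilityMeasure (i : Fin n) :
    IsProbabilityMeasure (if i ∈ S then iidLaw f₁ else iidLaw f₀) := by
  split_ifs <;> infer_instance

instance dataLaw_isProbabilityMeasure : IsProbabilityMeasure (dataLaw f₀ f₁ S) := by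
  unfold dataLaw
  infer_instance

/-- The probability that the component `i` is classified correctly when the support is `S`. -/
noncomputable def componentCorrect (i : Fin n) : ℝ :=
  if i ∈ S then 1 - (T i).falseNegative f₁ else 1 - (T i).falsePositive f₀

theorem componentCorrect_nonneg (i : Fin n) : 0 ≤ componentCorrect T f₀ f₁ S i := by
  unfold componentCorrect
  split_ifs
  · exact sub_nonneg.2 ((T i).falseNegative_le_one f₁)
  · exact sub_nonneg.2 ((T i).falsePositive_le_one f₀)

theorem componentCorrect_le_one (i : Fin n) : componentCorrect T f₀ f₁ S i ≤ 1 := by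
  unfold componentCorrect
  split_ifs
  · exact sub_le_self _ ((T i).falseNegative_nonneg f₁)
  · exact sub_le_self _ ((T i).falsePositive_nonneg f₀)

/-- The estimate is exact iff every component is classified correctly, and these events are
independent across components. -/
theorem one_sub_errorProb :
    1 - errorProb T f₀ f₁ S = ∏ i, componentCorrect T f₀ f₁ S i := by
  have hset : {y : Fin n → ℕ → Y | estimate T y ≠ S}ᶜ =
      Set.pi Set.univ (fun i => {y | (T i).accept y = decide (i ∈ S)}) := by
    ext y
    simp only [Set.mem_compl_iff, Set.mem_ofPred_eq, not_not, Set.mem_pi, Set.mem_univ,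
      true_implies, Finset.ext_iff, estimate, Finset.mem_filter, Finset.mem_univ, true_and]
    refine forall_congr' fun i => ?_
    by_cases hi : i ∈ S <;> simp [hi]
  have hm : ∀ i, MeasurableSet {y | (T i).accept y = decide (i ∈ S)} := fun i =>
    (T i).measurable_accept (measurableSet_singleton _)
  have hE : MeasurableSet {y : Fin n → ℕ → Y | estimate T y ≠ S} := by
    rw [← MeasurableSet.compl_iff, hset]
    exact MeasurableSet.univ_pi hm
  unfold errorProb
  rw [← probReal_compl_eq_one_sub hE, hset, measureReal_def]
  unfold dataLaw
  rw [Measure.pi_pi, ENNReal.toReal_prod]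
  refine Finset.prod_congr rfl fun i _ => ?_
  rw [← measureReal_def]
  unfold componentCorrect
  split_ifs with hi
  · simpa [hi] using (T i).real_accept f₁
  · simpa [hi] using (T i).real_reject f₀

theorem errorProb_le_one : errorProb T f₀ f₁ S ≤ 1 := measureReal_le_one

theorem expectedMeasurements_eq :
    expectedMeasurements T f₀ f₁ S =
      ∑ i, ∫⁻ y, (T i).numMeasurements y ∂(if i ∈ S then iidLaw f₁ else iidLaw f₀) := by
  unfold expectedMeasurements
  have hm : ∀ i ∈ Finset.univ, Measurable fun y : Fin n → ℕ → Y => (T i).numMeasurements (y i) :=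
    fun i _ => (T i).measurable_numMeasurements.comp (measurable_pi_apply i)
  rw [lintegral_finsetSum _ hm]
  refine Finset.sum_congr rfl fun i _ => ?_
  unfold dataLaw
  exact (measurePreserving_eval (fun i => if i ∈ S then iidLaw f₁ else iidLaw f₀) i).lintegral_comp
    (T i).measurable_numMeasurements

/-- The expected number of measurements of the components outside the support. -/
theorem sum_compl_le_expectedMeasurements :
    ∑ i ∈ Sᶜ, ∫⁻ y, (T i).numMeasurements y ∂(iidLaw f₀) ≤ expectedMeasurements T f₀ f₁ S := by
  rw [expectedMeasurements_eq, ← Finset.sum_compl_add_sum S]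
  refine le_add_right (Finset.sum_le_sum fun i hi => ?_)
  rw [if_neg (Finset.mem_compl.1 hi)]

end SequentialProcedure

namespace SequentialTest

variable {Y : Type*} [MeasurableSpace Y] (T : SequentialTest Y)
variable (f₀ f₁ : Measure Y) [IsProbabilityMeasure f₀] [IsProbabilityMeasure f₁]

/-- A test with few measurements on average under `f₀` has a large error probability. -/
theorem error_large (hD : klDiv f₀ f₁ ≠ ∞) {v w l : ℝ} (hw0 : 0 ≤ w) (hw1 : w ≤ 1)
    (hl0 : 0 ≤ l) (hl : Real.log 2 ≤ (w - v) / 2 * l)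
    (hN : ∫⁻ y, T.numMeasurements y ∂(iidLaw f₀) ≠ ∞)
    (hv : (klDiv f₀ f₁).toReal * (∫⁻ y, T.numMeasurements y ∂(iidLaw f₀)).toReal ≤ v * l) :
    (w - v) / 2 < T.falsePositive f₀ ∨ Real.exp (-(w * l)) ≤ T.falseNegative f₁ := by
  by_contra! hcon
  obtain ⟨hα, hβ⟩ := hcon
  -- With `c = w * l` both error bounds negated, the left side is at least `(w + v) / 2 * l` and the
  -- right side is below `v * l + log 2`, which is no larger.
  have hkey := T.mul_one_sub_falsePositive_le f₀ f₁ hD hN (mul_nonneg hw0 hl0)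
  have hβ0 : 0 ≤ T.falseNegative f₁ := T.falseNegative_nonneg f₁
  have hα0 : 0 ≤ T.falsePositive f₀ := T.falsePositive_nonneg f₀
  have hlt : Real.log (1 + T.falseNegative f₁ * Real.exp (w * l)) < Real.log 2 := by
    refine Real.log_lt_log (by positivity) ?_
    have := mul_lt_mul_of_pos_right hβ (Real.exp_pos (w * l))
    rw [← Real.exp_add, neg_add_cancel, Real.exp_zero] at this
    linarith
  have h1 : w * l * T.falsePositive f₀ ≤ l * ((w - v) / 2) := by
    have : w * l ≤ l := mul_le_of_le_one_left hl0 hw1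
    exact mul_le_mul this hα hα0 hl0
  nlinarith

end SequentialTest

namespace SequentialProcedure

variable {Y : Type*} [MeasurableSpace Y] {n : ℕ} (T : SequentialProcedure Y n)
  (f₀ f₁ : Measure Y) [IsProbabilityMeasure f₀] [IsProbabilityMeasure f₁] (S : Finset (Fin n))

/-- Many components with a large false positive probability make an error likely. -/
theorem one_sub_errorProb_le_of_falsePositive {A : Finset (Fin n)} {η : ℝ} (hη : 0 ≤ η)
    (hA : ∀ i ∈ A, η ≤ (T i).falsePositive f₀) :
    1 - errorProb T f₀ f₁ S ≤ Real.exp (-(η * ((A.card : ℝ) - S.card))) := by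
  have h : ∀ i, componentCorrect T f₀ f₁ S i ≤ Real.exp (-(if i ∈ A \ S then η else 0)) := by
    intro i
    split_ifs with hi
    · rw [Finset.mem_sdiff] at hi
      refine le_trans ?_ (Real.one_sub_le_exp_neg η)
      rw [componentCorrect, if_neg hi.2]
      exact sub_le_sub_left (hA i hi.1) 1
    · simpa using componentCorrect_le_one T f₀ f₁ S i
  rw [one_sub_errorProb]
  refine (Finset.prod_le_prod (fun i _ => componentCorrect_nonneg T f₀ f₁ S i)
    fun i _ => h i).trans ?_
  rw [← Real.exp_sum, Finset.sum_neg_distrib, Finset.sum_ite_mem, Finset.univ_inter,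
    Finset.sum_const, nsmul_eq_mul, mul_comm]
  refine Real.exp_le_exp.2 (neg_le_neg (mul_le_mul_of_nonneg_left ?_ hη))
  rw [sub_le_iff_le_add]
  exact_mod_cast Finset.card_le_card_sdiff_add_card

theorem one_sub_errorProb_le_prod :
    1 - errorProb T f₀ f₁ S ≤ ∏ i ∈ S, (1 - (T i).falseNegative f₁) := by
  rw [one_sub_errorProb]
  have h : ∀ i, componentCorrect T f₀ f₁ S i ≤
      if i ∈ S then 1 - (T i).falseNegative f₁ else 1 := by
    intro i
    split_ifs with hi
    · simp [componentCorrect, hi]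
    · exact componentCorrect_le_one T f₀ f₁ S i
  refine (Finset.prod_le_prod (fun i _ => componentCorrect_nonneg T f₀ f₁ S i)
    fun i _ => h i).trans ?_
  rw [Finset.prod_ite_mem, Finset.univ_inter]

theorem one_sub_avgErrorProb {s : ℕ} (hs : s ≤ n) :
    1 - avgErrorProb T f₀ f₁ s =
      (∑ S ∈ Finset.powersetCard s (Finset.univ : Finset (Fin n)), (1 - errorProb T f₀ f₁ S)) /
        (n.choose s : ℝ) := by
  have hpos : (n.choose s : ℝ) ≠ 0 := by exact_mod_cast (Nat.choose_pos hs).ne'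
  unfold avgErrorProb
  rw [Finset.sum_sub_distrib, sub_div]
  congr 1
  rw [Finset.sum_const, Finset.card_powersetCard, Finset.card_univ, Fintype.card_fin,
    nsmul_eq_mul, mul_one, div_self hpos]

theorem avgErrorProb_le_one {s : ℕ} (hs : s ≤ n) : avgErrorProb T f₀ f₁ s ≤ 1 := by
  rw [← sub_nonneg, one_sub_avgErrorProb T f₀ f₁ hs]
  exact div_nonneg (Finset.sum_nonneg fun S _ => sub_nonneg.2 (errorProb_le_one T f₀ f₁ S))
    (Nat.cast_nonneg _)

/-- Lower bound for the family-wise error rate when the error probabilities are common to all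
components. -/
theorem one_sub_errorProb_le_of_common {α β η b : ℝ} (hη : 0 ≤ η)
    (hα : ∀ i, (T i).falsePositive f₀ = α) (hβ : ∀ i, (T i).falseNegative f₁ = β)
    (h : η < α ∨ b ≤ β) :
    1 - errorProb T f₀ f₁ S ≤
      Real.exp (-(η * ((n : ℝ) - S.card))) + Real.exp (-(b * S.card)) := by
  rcases h with h | h
  · refine le_add_of_le_of_nonneg ?_ (Real.exp_pos _).le
    have := one_sub_errorProb_le_of_falsePositive T f₀ f₁ S (A := Finset.univ) hη
      fun i _ => by rw [hα]; exact h.le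
    simpa using this
  · refine le_add_of_nonneg_of_le (Real.exp_pos _).le ?_
    refine (one_sub_errorProb_le_prod T f₀ f₁ S).trans ?_
    calc ∏ i ∈ S, (1 - (T i).falseNegative f₁) ≤ ∏ _i ∈ S, Real.exp (-b) := by
          refine Finset.prod_le_prod (fun i _ => sub_nonneg.2 ((T i).falseNegative_le_one f₁))
            fun i _ => ?_
          rw [hβ]
          exact (sub_le_sub_left h 1).trans (Real.one_sub_le_exp_neg b)
      _ = Real.exp (-(b * S.card)) := by
          rw [Finset.prod_const, ← Real.exp_nat_mul]
          ring_nf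

/-- Lower bound for the mean family-wise error rate under a uniformly distributed support. -/
theorem one_sub_avgErrorProb_le {s : ℕ} {ρ η b : ℝ} (hρ0 : 0 ≤ ρ) (hρ1 : ρ ≤ 1) (hη : 0 ≤ η)
    (hb0 : 0 ≤ b) (hb1 : b ≤ 1) (hs : (s : ℝ) ≤ ρ / 4 * n)
    {G : Finset (Fin n)} (hG : ρ * n ≤ G.card)
    (h : ∀ i ∈ G, η < (T i).falsePositive f₀ ∨ b ≤ (T i).falseNegative f₁) :
    1 - avgErrorProb T f₀ f₁ s ≤
      Real.exp (-(η * (ρ / 4 * n))) + Real.exp (-(ρ / 4 * (b * s))) := by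
  classical
  have hn0 : (0 : ℝ) ≤ n := Nat.cast_nonneg n
  have hsn : s ≤ n := by
    have : (s : ℝ) ≤ n := by nlinarith
    exact_mod_cast this
  have hpos : 0 < (n.choose s : ℝ) := by exact_mod_cast Nat.choose_pos hsn
  rw [one_sub_avgErrorProb T f₀ f₁ hsn]
  set A := Finset.univ.filter fun i => η < (T i).falsePositive f₀ with hA
  set B := Finset.univ.filter fun i => b ≤ (T i).falseNegative f₁ with hB
  have hAB : (G.card : ℝ) ≤ A.card + B.card := by
    have hsub : G ⊆ A ∪ B := fun i hi => by
      simpa [hA, hB] using h i hi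
    exact_mod_cast (Finset.card_le_card hsub).trans (Finset.card_union_le A B)
  -- One alternative holds on at least `ρ / 2 * n` components; since `s ≤ ρ / 4 * n`, a margin of `ρ
  -- / 4 * n` survives the support in either case.
  rcases le_total (ρ / 2 * n) (A.card : ℝ) with hc | hc
  · refine le_add_of_le_of_nonneg ?_ (Real.exp_pos _).le
    rw [div_le_iff₀ hpos]
    have hle : ∀ S ∈ Finset.powersetCard s (Finset.univ : Finset (Fin n)),
        1 - errorProb T f₀ f₁ S ≤ Real.exp (-(η * (ρ / 4 * n))) := by
      intro S hS
      refine (one_sub_errorProb_le_of_falsePositive T f₀ f₁ S hη (A := A) fun i hi => ?_).trans ?_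
      · exact (Finset.mem_filter.1 hi).2.le
      · rw [(Finset.mem_powersetCard.1 hS).2]
        exact Real.exp_le_exp.2 (neg_le_neg (mul_le_mul_of_nonneg_left (by linarith) hη))
    refine (Finset.sum_le_card_nsmul _ _ _ hle).trans (le_of_eq ?_)
    rw [Finset.card_powersetCard, Finset.card_univ, Fintype.card_fin, nsmul_eq_mul, mul_comm]
  · refine le_add_of_nonneg_of_le (Real.exp_pos _).le ?_
    rw [div_le_iff₀ hpos]
    have hbρ : b * (ρ / 4) ≤ 1 := by nlinarith
    have hsum := sum_powersetCard_prod_le (x := fun i => 1 - (T i).falseNegative f₁)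
      (fun i => sub_nonneg.2 ((T i).falseNegative_le_one f₁))
      (fun i => sub_le_self _ ((T i).falseNegative_nonneg f₁)) (B := B) (κ := ρ / 4) (s := s)
      hb0 (by positivity) hbρ (fun i hi => sub_le_sub_left (Finset.mem_filter.1 hi).2 1)
      (by rw [Fintype.card_fin]; linarith)
    rw [Fintype.card_fin] at hsum
    refine (Finset.sum_le_sum fun S _ => one_sub_errorProb_le_prod T f₀ f₁ S).trans
      (hsum.trans ?_)
    rw [mul_comm]
    refine mul_le_mul_of_nonneg_right ?_ hpos.le
    refine (pow_le_pow_left₀ (sub_nonneg.2 hbρ) (Real.one_sub_le_exp_neg _) s).trans (le_of_eq ?_)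
    rw [← Real.exp_nat_mul]
    ring_nf

/-- The mean number of measurements under a uniformly distributed support bounds the expected
numbers of measurements under `f₀`. -/
theorem sum_lintegral_numMeasurements_le {s : ℕ} (hs : s < n) {m : ℝ≥0}
    (h : avgExpectedMeasurements T f₀ f₁ s ≤ (n : ℝ≥0∞) * m) :
    (∀ i, ∫⁻ y, (T i).numMeasurements y ∂(iidLaw f₀) ≠ ∞) ∧
      ((n : ℝ) - s) * ∑ i, (∫⁻ y, (T i).numMeasurements y ∂(iidLaw f₀)).toReal ≤
        (n : ℝ) * (n * m) := by
  have hC : 0 < n.choose s := Nat.choose_pos hs.le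
  have hC0 : (n.choose s : ℝ≥0∞) ≠ 0 := by exact_mod_cast hC.ne'
  have hC' : 0 < (n - 1).choose s := Nat.choose_pos (by omega)
  unfold avgExpectedMeasurements at h
  rw [ENNReal.div_le_iff hC0 (ENNReal.natCast_ne_top _)] at h
  have h1 := (Finset.sum_le_sum fun S _ => sum_compl_le_expectedMeasurements T f₀ f₁ S).trans h
  rw [sum_powersetCard_sum_compl, Fintype.card_fin, nsmul_eq_mul] at h1
  have htop : (n : ℝ≥0∞) * m * n.choose s ≠ ∞ := by finiteness
  have hfin : ∑ i, ∫⁻ y, (T i).numMeasurements y ∂(iidLaw f₀) ≠ ∞ := by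
    intro htop'
    rw [htop', ENNReal.mul_top (by exact_mod_cast hC'.ne')] at h1
    exact htop (top_le_iff.1 h1)
  have hfin' : ∀ i, ∫⁻ y, (T i).numMeasurements y ∂(iidLaw f₀) ≠ ∞ := fun i =>
    ENNReal.sum_ne_top.1 hfin i (Finset.mem_univ i)
  refine ⟨hfin', ?_⟩
  have h2 := ENNReal.toReal_mono htop h1
  simp only [ENNReal.toReal_mul, ENNReal.toReal_natCast, ENNReal.coe_toReal] at h2
  rw [ENNReal.toReal_sum fun i _ => hfin' i] at h2
  -- A given component lies off the support for a fraction `(n - s) / n` of the supports.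
  have hid : (n : ℝ) * (n - 1).choose s = n.choose s * (n - s) := by
    have := Nat.choose_mul_succ_eq (n - 1) s
    rw [Nat.sub_add_cancel (by omega)] at this
    rw [← Nat.cast_sub hs.le, mul_comm]
    exact_mod_cast this
  have hCr : (0 : ℝ) < n.choose s := by exact_mod_cast hC
  refine le_of_mul_le_mul_left ?_ hCr
  have h3 := mul_le_mul_of_nonneg_left h2 (Nat.cast_nonneg n)
  rw [← mul_assoc, hid] at h3
  linarith

end SequentialProcedure

/-! ### Constants and limits. -/

theorem ENNReal.ne_top_and_mul_toReal_lt_one {L : ℝ} {D : ℝ≥0∞} (h : ENNReal.ofReal L < D⁻¹) :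
    D ≠ ∞ ∧ D.toReal * L < 1 := by
  have hD : D ≠ ∞ := by
    rintro rfl
    simp at h
  refine ⟨hD, ?_⟩
  rcases le_or_gt L 0 with hL | hL
  · exact (mul_nonpos_of_nonneg_of_nonpos ENNReal.toReal_nonneg hL).trans_lt one_pos
  rcases eq_or_ne D 0 with h0 | h0
  · simp [h0]
  have h1 := (ENNReal.toReal_lt_toReal ENNReal.ofReal_ne_top (ENNReal.inv_ne_top.2 h0)).2 h
  rw [ENNReal.toReal_ofReal hL.le, ENNReal.toReal_inv] at h1
  have hpos : 0 < D.toReal := ENNReal.toReal_pos h0 hD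
  have h2 := mul_lt_mul_of_pos_left h1 hpos
  rwa [mul_inv_cancel₀ hpos.ne'] at h2

/-- Constants that leave room below the threshold for the number of measurements. -/
theorem exists_regime_constants {s : ℕ → ℕ} (hs_top : Tendsto s atTop atTop)
    (hs_sparse : Tendsto (fun n : ℕ => (s n : ℝ) / (n : ℝ)) atTop (𝓝 0))
    {m : ℕ → ℝ≥0} {L D : ℝ}
    (hL : Tendsto (fun n : ℕ => (m n : ℝ) / Real.log (s n : ℝ)) atTop (𝓝 L)) (hDL : D * L < 1) :
    ∃ v w ρ : ℝ, 0 < v ∧ v < w ∧ w < 1 ∧ 0 < ρ ∧ ρ ≤ 1 ∧ ∀ᶠ n in atTop,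
      0 < n ∧ (s n : ℝ) ≤ ρ / 4 * n ∧ 0 < Real.log (s n) ∧
        Real.log 2 ≤ (w - v) / 2 * Real.log (s n) ∧
        D * m n ≤ v * (1 - 2 * ρ) * Real.log (s n) := by
  -- `D * L` may be zero, so the maximum with `0` keeps `u` positive. The choice `ρ = (1 - u / v) /
  -- 2` below makes `v * (1 - 2 * ρ) = u`.
  obtain ⟨u, hu, hu1⟩ := exists_between (max_lt hDL one_pos)
  have hu0 : 0 < u := (le_max_right _ _).trans_lt hu
  have huL : D * L < u := (le_max_left _ _).trans_lt hu
  obtain ⟨v, huv, hv1⟩ := exists_between hu1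
  obtain ⟨w, hvw, hw1⟩ := exists_between hv1
  have hv0 : 0 < v := hu0.trans huv
  have hρ0 : 0 < (1 - u / v) / 2 := by
    have : u / v < 1 := (div_lt_one hv0).2 huv
    linarith
  have hρ1 : (1 - u / v) / 2 ≤ 1 := by
    have : 0 < u / v := by positivity
    linarith
  have hlog : Tendsto (fun n => Real.log (s n)) atTop atTop :=
    Real.tendsto_log_atTop.comp (tendsto_natCast_atTop_atTop.comp hs_top)
  refine ⟨v, w, (1 - u / v) / 2, hv0, hvw, hw1, hρ0, hρ1, ?_⟩
  have hδ : 0 < (w - v) / 2 := by linarith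
  filter_upwards [eventually_gt_atTop 0,
    hs_sparse.eventually (gt_mem_nhds (by positivity : 0 < (1 - u / v) / 2 / 4)),
    hlog.eventually_gt_atTop 0,
    (hlog.const_mul_atTop hδ).eventually_ge_atTop (Real.log 2),
    (hL.const_mul D).eventually (gt_mem_nhds huL)] with n hn hsn hl hl2 hm
  have hn' : (0 : ℝ) < n := by exact_mod_cast hn
  refine ⟨hn, ((div_lt_iff₀ hn').1 hsn).le, hl, hl2, ?_⟩
  rw [← mul_div_assoc, div_lt_iff₀ hl] at hm
  have : v * (1 - 2 * ((1 - u / v) / 2)) = u := by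
    field_simp
    ring
  rw [this]
  exact hm.le

/-- The second exponent is `-ρ * s ^ (1 - w)`, and `w < 1` sends it to `-∞`. -/
theorem tendsto_exp_add_exp_zero {s : ℕ → ℕ} (hs_top : Tendsto s atTop atTop) {w ρ η : ℝ}
    (hw : w < 1) (hρ : 0 < ρ) (hη : 0 < η) :
    Tendsto (fun n : ℕ => Real.exp (-(η * (ρ * n))) +
      Real.exp (-(ρ * (Real.exp (-(w * Real.log (s n))) * s n)))) atTop (𝓝 0) := by
  have hlog : Tendsto (fun n => Real.log (s n)) atTop atTop :=
    Real.tendsto_log_atTop.comp (tendsto_natCast_atTop_atTop.comp hs_top)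
  have h1 : Tendsto (fun n : ℕ => η * (ρ * (n : ℝ))) atTop atTop :=
    (tendsto_natCast_atTop_atTop.const_mul_atTop hρ).const_mul_atTop hη
  have h2 : Tendsto (fun n => Real.exp (-(w * Real.log (s n))) * s n) atTop atTop := by
    refine Tendsto.congr' ?_ (Real.tendsto_exp_atTop.comp
      (hlog.const_mul_atTop (by linarith : 0 < 1 - w)))
    filter_upwards [hs_top.eventually_gt_atTop 0] with n hn
    have hn' : (0 : ℝ) < s n := by exact_mod_cast hn
    conv_rhs => rw [← Real.exp_log hn', Real.log_exp, ← Real.exp_add]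
    simp only [Function.comp_apply]
    congr 1
    ring
  simpa using (Real.tendsto_exp_neg_atTop_nhds_zero.comp h1).add
    (Real.tendsto_exp_neg_atTop_nhds_zero.comp (h2.const_mul_atTop hρ))

theorem tendsto_one_of_one_sub_le {a u : ℕ → ℝ} (ha : ∀ n, a n ≤ 1) (hu : Tendsto u atTop (𝓝 0))
    (h : ∀ᶠ n in atTop, 1 - a n ≤ u n) : Tendsto a atTop (𝓝 1) := by
  have h0 : Tendsto (fun n => 1 - a n) atTop (𝓝 0) :=
    tendsto_of_tendsto_of_tendsto_of_le_of_le' tendsto_const_nhds hu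
      (Eventually.of_forall fun n => sub_nonneg.2 (ha n)) h
  simpa using h0.const_sub 1

/-! ### Cheap components, and the conclusion. -/

namespace SequentialProcedure

variable {Y : Type*} [MeasurableSpace Y] {n : ℕ} (T : SequentialProcedure Y n)
  (f₀ f₁ : Measure Y) [IsProbabilityMeasure f₀] [IsProbabilityMeasure f₁]

/-- Some component outside the support has few measurements on average. -/
theorem exists_few_measurements {S : Finset (Fin n)} {m : ℝ≥0} {v l ρ D : ℝ} (hD : 0 ≤ D)
    (hn : 0 < n) (hv : 0 < v) (hl : 0 < l) (hρ : 0 < ρ) (hS : (S.card : ℝ) ≤ ρ / 4 * n)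
    (hm : D * m ≤ v * (1 - 2 * ρ) * l)
    (h : expectedMeasurements T f₀ f₁ S ≤ (n : ℝ≥0∞) * m) :
    ∃ i, ∫⁻ y, (T i).numMeasurements y ∂(iidLaw f₀) ≠ ∞ ∧
      D * (∫⁻ y, (T i).numMeasurements y ∂(iidLaw f₀)).toReal ≤ v * l := by
  have h1 := (sum_compl_le_expectedMeasurements T f₀ f₁ S).trans h
  have htop : (n : ℝ≥0∞) * m ≠ ∞ := by finiteness
  have hfin : ∀ i ∈ Sᶜ, ∫⁻ y, (T i).numMeasurements y ∂(iidLaw f₀) ≠ ∞ :=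
    ENNReal.sum_ne_top.1 (ne_top_of_le_ne_top htop h1)
  have h2 := ENNReal.toReal_mono htop h1
  rw [ENNReal.toReal_sum hfin, ENNReal.toReal_mul, ENNReal.toReal_natCast,
    ENNReal.coe_toReal] at h2
  -- Otherwise the components off `S` alone would cost at least `(1 - ρ / 4) * n * v * l` after
  -- scaling by `D`, above the budget `(1 - 2 * ρ) * n * v * l`.
  by_contra! hcon
  have h3 := Finset.card_nsmul_le_sum Sᶜ
    (fun i => D * (∫⁻ y, (T i).numMeasurements y ∂(iidLaw f₀)).toReal) (v * l)
    fun i hi => (hcon i (hfin i hi)).le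
  rw [nsmul_eq_mul, ← Finset.mul_sum, Finset.card_compl, Fintype.card_fin,
    Nat.cast_sub (by simpa using Finset.card_le_univ S)] at h3
  have h4 := mul_le_mul_of_nonneg_left h2 hD
  have hn' : (0 : ℝ) < n := by exact_mod_cast hn
  have hvl : 0 < v * l := mul_pos hv hl
  have h5 : (n : ℝ) * (D * m) ≤ n * (v * (1 - 2 * ρ) * l) := mul_le_mul_of_nonneg_left hm hn'.le
  have h6 : ((n : ℝ) - ρ / 4 * n) * (v * l) ≤ (n - S.card) * (v * l) :=
    mul_le_mul_of_nonneg_right (by linarith) hvl.le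
  have h7 : 0 < n * ρ * (v * l) := by positivity
  nlinarith

/-- A positive fraction of the components has few measurements on average. -/
theorem card_few_measurements_ge {s : ℕ} {m : ℝ≥0} {v l ρ D : ℝ} (hD : 0 ≤ D)
    (hn : 0 < n) (hv : 0 < v) (hl : 0 < l) (hρ : 0 < ρ) (hρ1 : ρ ≤ 1)
    (hs : (s : ℝ) ≤ ρ / 4 * n) (hm : D * m ≤ v * (1 - 2 * ρ) * l)
    (h : ((n : ℝ) - s) * ∑ i, (∫⁻ y, (T i).numMeasurements y ∂(iidLaw f₀)).toReal ≤
      (n : ℝ) * (n * m)) :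
    ρ * n ≤ (Finset.univ.filter fun i =>
      D * (∫⁻ y, (T i).numMeasurements y ∂(iidLaw f₀)).toReal ≤ v * l).card := by
  set e : Fin n → ℝ := fun i => (∫⁻ y, (T i).numMeasurements y ∂(iidLaw f₀)).toReal with he
  set G := Finset.univ.filter fun i => D * e i ≤ v * l with hG
  have hn' : (0 : ℝ) < n := by exact_mod_cast hn
  have hvl : 0 < v * l := mul_pos hv hl
  have h1 : (Gᶜ.card : ℝ) * (v * l) ≤ D * ∑ i, e i := by
    have := Finset.card_nsmul_le_sum Gᶜ (fun i => D * e i) (v * l) fun i hi => by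
      simp only [hG, Finset.mem_compl, Finset.mem_filter, Finset.mem_univ, true_and,
        not_le] at hi
      exact hi.le
    rw [nsmul_eq_mul] at this
    refine this.trans ?_
    rw [Finset.mul_sum]
    exact Finset.sum_le_univ_sum_of_nonneg fun i => mul_nonneg hD ENNReal.toReal_nonneg
  rw [Finset.card_compl, Fintype.card_fin,
    Nat.cast_sub (by simpa using Finset.card_le_univ G)] at h1
  by_contra! hcon
  have hns : n * (1 - ρ / 4) ≤ (n : ℝ) - s := by linarith
  have hns0 : 0 < n * (1 - ρ / 4) := mul_pos hn' (by linarith)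
  have hns1 : 0 ≤ (n : ℝ) - s := hns0.le.trans hns
  have hG' : n * (1 - ρ) ≤ (n : ℝ) - G.card := by linarith
  have hρ' : 0 ≤ n * (1 - ρ) := mul_nonneg hn'.le (by linarith)
  have h2 : n * (1 - ρ / 4) * (n * (1 - ρ)) * (v * l) ≤ n * (n * (D * m)) :=
    calc n * (1 - ρ / 4) * (n * (1 - ρ)) * (v * l)
        ≤ (n - s) * (n - G.card) * (v * l) := by gcongr
      _ = (n - s) * ((n - G.card) * (v * l)) := by ring
      _ ≤ (n - s) * (D * ∑ i, e i) := mul_le_mul_of_nonneg_left h1 hns1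
      _ = D * ((n - s) * ∑ i, e i) := by ring
      _ ≤ D * (n * (n * m)) := mul_le_mul_of_nonneg_left h hD
      _ = n * (n * (D * m)) := by ring
  -- The contradiction is `(1 - ρ / 4) * (1 - ρ) > 1 - 2 * ρ`, with gap `3 * ρ / 4 + ρ ^ 2 / 4`.
  have h3 : (n : ℝ) * (n * (D * m)) ≤ n * (n * (v * (1 - 2 * ρ) * l)) := by gcongr
  have h4 : 0 < n * n * (v * l) * ρ := by positivity
  have h5 : 0 < n * n * (v * l) * ρ * ρ := by positivity
  nlinarith

end SequentialProcedure

theorem theorem2 {Y : Type*} [MeasurableSpace Y] (f₀ f₁ : Measure Y)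
    [IsProbabilityMeasure f₀] [IsProbabilityMeasure f₁]
    (s : ℕ → ℕ) (hs_le : ∀ n, s n ≤ n)
    (hs_top : Tendsto s atTop atTop)
    (hs_sparse : Tendsto (fun n : ℕ => (s n : ℝ) / (n : ℝ)) atTop (𝓝 0))
    (m : ℕ → ℝ≥0) (L : ℝ)
    (hL : Tendsto (fun n : ℕ => (m n : ℝ) / Real.log (s n : ℝ)) atTop (𝓝 L))
    (hLD : ENNReal.ofReal L < (klDiv f₀ f₁)⁻¹) :
    -- a given support, error probabilities common to all the components
    (∀ (S : (n : ℕ) → Finset (Fin n)) (T : (n : ℕ) → SequentialProcedure Y n) (α β : ℕ → ℝ),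
      (∀ n, (S n).card = s n) →
      (∀ n i, (T n i).falsePositive f₀ = α n) →
      (∀ n i, (T n i).falseNegative f₁ = β n) →
      (∀ n, (T n).expectedMeasurements f₀ f₁ (S n) ≤ (n : ℝ≥0∞) * (m n : ℝ≥0∞)) →
      Tendsto (fun n => (T n).errorProb f₀ f₁ (S n)) atTop (𝓝 1)) ∧
    -- tests that differ from component to component, a uniformly distributed support
    (∀ T : (n : ℕ) → SequentialProcedure Y n,
      (∀ n, (T n).avgExpectedMeasurements f₀ f₁ (s n) ≤ (n : ℝ≥0∞) * (m n : ℝ≥0∞)) →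
      Tendsto (fun n => (T n).avgErrorProb f₀ f₁ (s n)) atTop (𝓝 1)) := by
  obtain ⟨hD, hDL⟩ := ENNReal.ne_top_and_mul_toReal_lt_one hLD
  obtain ⟨v, w, ρ, hv, hvw, hw, hρ, hρ1, hev⟩ :=
    exists_regime_constants hs_top hs_sparse hL hDL
  have hη : 0 < (w - v) / 2 := by linarith
  have hw0 : 0 ≤ w := (hv.trans hvw).le
  have hlim := tendsto_exp_add_exp_zero hs_top hw (by positivity : 0 < ρ / 4) hη
  refine ⟨fun S T α β hS hα hβ hT => ?_, fun T hT => ?_⟩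
  · refine tendsto_one_of_one_sub_le
      (fun n => SequentialProcedure.errorProb_le_one (T n) f₀ f₁ (S n)) hlim ?_
    filter_upwards [hev] with n ⟨hn, hsn, hl, hl2, hm⟩
    obtain ⟨i, hfin, hi⟩ := SequentialProcedure.exists_few_measurements (T n) f₀ f₁
      ENNReal.toReal_nonneg hn hv hl hρ (by rwa [hS n]) hm (hT n)
    have herr := (T n i).error_large f₀ f₁ hD hw0 hw.le hl.le hl2 hfin hi
    rw [hα, hβ] at herr
    refine (SequentialProcedure.one_sub_errorProb_le_of_common (T n) f₀ f₁ (S n) hη.le (hα n)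
      (hβ n) herr).trans (add_le_add ?_ ?_)
    -- The sharper exponents, with `n - s` and without `ρ / 4`, are weakened so that both parts
    -- share the limit `hlim`.
    · rw [hS n]
      refine Real.exp_le_exp.2 (neg_le_neg (mul_le_mul_of_nonneg_left ?_ hη.le))
      nlinarith [(Nat.cast_nonneg n : (0 : ℝ) ≤ n)]
    · rw [hS n]
      refine Real.exp_le_exp.2 (neg_le_neg (mul_le_of_le_one_left (by positivity) ?_))
      linarith
  · refine tendsto_one_of_one_sub_le
      (fun n => SequentialProcedure.avgErrorProb_le_one (T n) f₀ f₁ (hs_le n)) hlim ?_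
    filter_upwards [hev] with n ⟨hn, hsn, hl, hl2, hm⟩
    have hsn' : s n < n := by
      have hn' : (0 : ℝ) < n := by exact_mod_cast hn
      have : (s n : ℝ) < n := by nlinarith
      exact_mod_cast this
    obtain ⟨hfin, hsum⟩ := SequentialProcedure.sum_lintegral_numMeasurements_le (T n) f₀ f₁ hsn'
      (hT n)
    have hG := SequentialProcedure.card_few_measurements_ge (T n) f₀ ENNReal.toReal_nonneg hn hv
      hl hρ hρ1 hsn hm hsum
    refine SequentialProcedure.one_sub_avgErrorProb_le (T n) f₀ f₁ hρ.le hρ1 hη.le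
      (Real.exp_pos _).le (Real.exp_le_one_iff.2 (neg_nonpos.2 (mul_nonneg hw0 hl.le))) hsn hG
      fun i hi => ?_
    exact (T n i).error_large f₀ f₁ hD hw0 hw.le hl.le hl2 (hfin i) (Finset.mem_filter.1 hi).2
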